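/- \textbf{Conventions.} A constraint function of arity $n\ge 1$ on a finite set $V$ is a function $F:V^n\to\mathbb C$. A set $\mathcal F$ of constraint functions on a common domain $V(\mathcal F)$ is \emph{conjugate closed} if $F\in\mathcal F\iff\overline F\in\mathcal F$, where $\overline F$ is the entrywise conjugate. Let $\mathcal F=\{F_i\}_{i\in I}$ and $\mathcal G=\{G_i\}_{i\in I}$ be indexed by the same set, with $F_i$ and $G_i$ of the same arity $n_i\ge1$ for every $i$ (\emph{corresponding} functions), on disjoint finite domains $V(\mathcal F)$ and $V(\mathcal G)$, not assumed to have the same size. \emph{Projective connectivity.} A matrix $X\in\mathbb C^{V\times V}$ is \emph{disconnected} if $V=I\sqcup J$ with $I,J$ nonempty and $X_{uv}=0$ unless $u,v\in I$ or $u,v\in J$; otherwise it is \emph{connected}. A constraint function $F$ of arity $n\ge2$ is \emph{projectively connected} if the matrix $X_{uv}=\sum_{x_1,\dots,x_{n-2}}F(x_1,\dots,x_{n-2},u,v)$ is connected. \emph{Direct sum.} For $F,G$ of arity $n\ge2$ on disjoint domains $V,W$, $F\oplus G$ is the function of arity $n$ on $V\sqcup W$ that equals $F$ on $V^n$, $G$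 on $W^n$ and $0$ elsewhere; for $n=1$, $F\oplus G$ is the binary function with $(F\oplus G)(z,z)=F(z)$ for $z\in V$, $(F\oplus G)(z,z)=G(z)$ for $z\in W$, and $(F\oplus G)(z,z')=0$ for $z\ne z'$. Let $\mathcal F\oplus\mathcal G=\{F_i\oplus G_i\}_{i\in I}$. \emph{Quantum notions.} A \emph{quantum permutation matrix} over a unital $C^*$-algebra is a square matrix whose entries are projections and whose rows and columns all sum to $1$. For constraint functions $f,g$ of arity $n$, $\mathcal U^{\otimes n}f=g$ means $\sum_{y}u_{x_1y_1}\cdots u_{x_ny_n}f(y)=g(x)\,1$ for all $x=(x_1,\dots,x_n)$. $C(\mathrm{Qut}(\mathcal H))$ is the universal unital $C^*$-algebra generated by the entries of a matrix $\mathcal U=(u_{xy})_{x,y\in V(\mathcal H)}$ subject to the relations that $\mathcal U$ is a quantum permutation matrix and $\mathcal U^{\otimes n}H=H$ for every $H\in\mathcal H$ of arity $n$; points $x,y$ are in the same orbit of $\mathrm{Qut}(\mathcal H)$ if $u_{xy}\neq0$. $\mathcal F$ and $\mathcal G$ are \emph{quantum isomorphic}, $\mathcal F\cong_{qc}\mathcal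 G$, if $|V(\mathcal F)|=|V(\mathcal G)|$ and over some nonzero unital $C^*$-algebra there is a single quantum permutation matrix $\mathcal U$, with rows indexed by $V(\mathcal G)$ and columns by $V(\mathcal F)$, such that $\mathcal U^{\otimes n_i}F_i=G_i$ for all $i\in I$. \textbf{Lemma.} Let $\mathcal F$ and $\mathcal G$ be as above and both conjugate closed, and suppose that for some $i\in I$ both $F_i$ and $G_i$ are projectively connected. If some $\hat x\in V(\mathcal F)$ and $\hat y\in V(\mathcal G)$ are in the same orbit of $\mathrm{Qut}(\mathcal F\oplus\mathcal G)$, then $\mathcal F\cong_{qc}\mathcal G$ (in particular $|V(\mathcal F)|=|V(\mathcal G)|$). -/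

import Mathlib

open scoped ENNReal

noncomputable section

/-! ### Constraint functions -/

/-- A constraint function (tensor) of arity `n` on the domain `V`. -/
abbrev Tensor (V : Type*) (n : ℕ) : Type _ := (Fin n → V) → ℂ

/-- The entrywise complex conjugate. -/
def Tensor.conj {V : Type*} {n : ℕ} (F : Tensor V n) : Tensor V n :=
  fun x => starRingEnd ℂ (F x)

/-- A set of constraint functions of arbitrary arities on a common domain `V`. -/
abbrev TensorSet (V : Type*) : Type _ := Set (Σ n : ℕ, Tensor V n)

/-- The set of constraint functions listed by an indexed family. -/
def tensorSet {V ι : Type*} {n : ι → ℕ} (F : ∀ i, Tensor V (n i)) : TensorSet V :=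
  Set.range fun i => ⟨n i, F i⟩

/-- `F ∈ S` if and only if the conjugate of `F` is in `S`. -/
def ConjClosed {V : Type*} (S : TensorSet V) : Prop :=
  ∀ (n : ℕ) (F : Tensor V n),
    (⟨n, F⟩ : Σ n : ℕ, Tensor V n) ∈ S ↔ (⟨n, F.conj⟩ : Σ n : ℕ, Tensor V n) ∈ S

/-! ### Connected weighted graphs and projective connectivity -/

/-- A `ℂ`-weighted graph is disconnected if its vertex set splits into two nonempty parts
with no edge of nonzero weight (in either direction) between them. -/
def IsDisconnected {V : Type*} (X : Matrix V V ℂ) : Prop :=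
  ∃ I J : Set V, I.Nonempty ∧ J.Nonempty ∧ I ∩ J = ∅ ∧ I ∪ J = Set.univ ∧
    ∀ u v, ¬ ((u ∈ I ∧ v ∈ I) ∨ (u ∈ J ∧ v ∈ J)) → X u v = 0

/-- The weighted graph `X u v = ∑ F (x₁, …, x_k, u, v)` of a tensor of arity `k + 2`. -/
def projectedGraph {V : Type*} [Fintype V] {k : ℕ} (F : Tensor V (k + 2)) : Matrix V V ℂ :=
  Matrix.of fun u v => ∑ x : Fin k → V, F (Fin.append x ![u, v])

/-- A constraint function of arity at least two is projectively connected if its projected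
graph is connected. -/
def ProjectivelyConnected {V : Type*} [Fintype V] : {n : ℕ} → Tensor V n → Prop
  | 0, _ => False
  | 1, _ => False
  | _ + 2, F => ¬ IsDisconnected (projectedGraph F)

/-! ### Direct sums -/

/-- The direct sum of two tensors of arity `n`, as a tensor of arity `n`: it vanishes on tuples
that are neither entirely in `V` nor entirely in `W`. -/
def blockSum {V W : Type*} {n : ℕ} (F : Tensor V n) (G : Tensor W n) : Tensor (V ⊕ W) n :=
  fun z =>
    if h : ∀ k, (z k).isLeft then F fun k => (z k).getLeft (h k)
    else if h : ∀ k, (z k).isRight then G fun k => (z k).getRight (h k)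
    else 0

/-- The direct sum of two unary functions, as a binary function: the diagonal matrix with
diagonal entries given by the two functions. -/
def unarySum {V W : Type*} (F : Tensor V 1) (G : Tensor W 1) : Tensor (V ⊕ W) 2 :=
  open Classical in fun z =>
    if z 0 = z 1 then Sum.elim (fun x => F ![x]) (fun y => G ![y]) (z 0) else 0

/-- The direct sum `F ⊕ G`, of arity `n` if `n ≠ 1` and of arity `2` if `n = 1`. -/
def directSum {V W : Type*} : (n : ℕ) → Tensor V n → Tensor W n → Σ m : ℕ, Tensor (V ⊕ W) m
  | 1, F, G => ⟨2, unarySum F G⟩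
  | n, F, G => ⟨n, blockSum F G⟩

/-- The set of the direct sums of corresponding members of two families. -/
def directSumSet {V W ι : Type*} {n : ι → ℕ} (F : ∀ i, Tensor V (n i))
    (G : ∀ i, Tensor W (n i)) : TensorSet (V ⊕ W) :=
  Set.range fun i => directSum (n i) (F i) (G i)

/-! ### Quantum permutation matrices and quantum isomorphism -/

/-- A quantum permutation matrix with entries in a unital C⋆-algebra: all entries are projections
and every row and every column sums to `1`. The rows and the columns may be indexed by two
different sets. -/
structure IsQuantumPermutation {V W A : Type*} [Fintype V] [Fintype W] [CStarAlgebra A]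
    (u : Matrix W V A) : Prop where
  isStarProjection : ∀ i j, IsStarProjection (u i j)
  row_sum : ∀ i, ∑ j, u i j = 1
  col_sum : ∀ j, ∑ i, u i j = 1

/-- The Kronecker power `u^{⊗ n}`, whose entry at `(x, y)` is the ordered product
`u (x 0) (y 0) * u (x 1) (y 1) * ⋯`. -/
def tensorPow {V W A : Type*} [CStarAlgebra A] (u : Matrix W V A) (n : ℕ) :
    Matrix (Fin n → W) (Fin n → V) A :=
  Matrix.of fun x y => (List.ofFn fun k => u (x k) (y k)).prod

/-- The relation `u^{⊗ n} f = g`, scalars being identified with multiples of the unit. -/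
def Carries {V W A : Type*} [Fintype V] [CStarAlgebra A] (u : Matrix W V A) {n : ℕ}
    (f : Tensor V n) (g : Tensor W n) : Prop :=
  (tensorPow u n).mulVec (fun y => algebraMap ℂ A (f y)) = fun x => algebraMap ℂ A (g x)

/-- Quantum isomorphism of two families of constraint functions with equal arities: the domains
have the same size, and over some nonzero unital C⋆-algebra a single quantum permutation matrix
carries every `F i` to `G i`. The algebra may be taken in `Type`, since the entries of `u` generate
a separable C⋆-algebra, which has at most continuum many elements. -/
def QuantumIsomorphic {V W ι : Type*} [Fintype V] [Fintype W] {n : ι → ℕ}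
    (F : ∀ i, Tensor V (n i)) (G : ∀ i, Tensor W (n i)) : Prop :=
  Fintype.card V = Fintype.card W ∧
    ∃ (A : Type) (_ : CStarAlgebra A) (_ : Nontrivial A) (u : Matrix W V A),
      IsQuantumPermutation u ∧ ∀ i, Carries u (F i) (G i)

/-! ### The quantum automorphism group -/

/-- The defining relations of the quantum automorphism group of `S`: the matrix is a quantum
permutation matrix and `u^{⊗ n} f = f` for every `f` in `S`. -/
structure QutRelations {V A : Type*} [Fintype V] [CStarAlgebra A] (S : TensorSet V)
    (u : Matrix V V A) : Prop where
  isQuantumPermutation : IsQuantumPermutation u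
  carries : ∀ F ∈ S, Carries u F.2 F.2

/-- A nonzero unital C⋆-algebra with a matrix that satisfies the defining relations. -/
structure QutRep {V : Type*} [Fintype V] (S : TensorSet V) where
  Alg : Type
  [cstar : CStarAlgebra Alg]
  [nontriv : Nontrivial Alg]
  mat : Matrix V V Alg
  rel : QutRelations S mat

attribute [instance] QutRep.cstar QutRep.nontriv

instance lpInftyCStarAlgebra {I : Type*} {A : I → Type*} [∀ i, Nontrivial (A i)]
    [∀ i, CStarAlgebra (A i)] : CStarAlgebra (lp A ∞) where

/-- The `ℓ^∞`-product of all C⋆-algebras with a matrix that satisfies the relations. -/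
abbrev QutProduct {V : Type*} [Fintype V] (S : TensorSet V) : Type _ :=
  lp (fun r : QutRep S => r.Alg) ∞

/-- The tuple of all matrices that satisfy the relations, as one matrix over the product. -/
def qutProductMatrix {V : Type*} [Fintype V] (S : TensorSet V) : Matrix V V (QutProduct S) :=
  Matrix.of fun x y => ⟨fun r : QutRep S => r.mat x y, by
    apply memℓp_infty
    refine ⟨1, ?_⟩
    rintro _ ⟨r, rfl⟩
    exact (r.rel.isQuantumPermutation.isStarProjection x y).norm_le⟩

/-- The closed unital ⋆-subalgebra of the product generated by the entries of the matrix. -/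
def qutSubalgebra {V : Type*} [Fintype V] (S : TensorSet V) :
    StarSubalgebra ℂ (QutProduct S) :=
  (StarAlgebra.adjoin ℂ
    (Set.range fun p : V × V => qutProductMatrix S p.1 p.2)).topologicalClosure

/-- The universal C⋆-algebra `C(Qut S)` generated by the entries of a matrix that satisfies the
defining relations. It is realized as the C⋆-algebra generated by the tuple of all
such matrices in the product over them; `Qut.existsUnique_hom` below is its universal property,
for C⋆-algebras in every universe. -/
def QutAlgebra {V : Type*} [Fintype V] (S : TensorSet V) : Type _ := qutSubalgebra S

instance QutAlgebra.instCStarAlgebra {V : Type*} [Fintype V] (S : TensorSet V) :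
    CStarAlgebra (QutAlgebra S) :=
  StarSubalgebra.cstarAlgebra (qutSubalgebra S)
    (h_closed := StarSubalgebra.isClosed_topologicalClosure _)

/-- The fundamental representation of the quantum automorphism group of `S`. -/
def Qut.fundamental {V : Type*} [Fintype V] (S : TensorSet V) : Matrix V V (QutAlgebra S) :=
  Matrix.of fun x y => ⟨qutProductMatrix S x y,
    StarSubalgebra.le_topologicalClosure _ (StarAlgebra.subset_adjoin ℂ _ ⟨(x, y), rfl⟩)⟩

/-- Two points lie in the same orbit of the quantum automorphism group of `S` if the
corresponding entry of the fundamental representation is nonzero. -/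
def Qut.SameOrbit {V : Type*} [Fintype V] (S : TensorSet V) (x y : V) : Prop :=
  Qut.fundamental S x y ≠ 0

/-! ### The universal property of `C(Qut S)` -/

theorem algHom_tensorPow {V W A B : Type*} [CStarAlgebra A] [CStarAlgebra B]
    (φ : A →⋆ₐ[ℂ] B) (u : Matrix W V A) (n : ℕ) (x : Fin n → W) (y : Fin n → V) :
    φ (tensorPow u n x y) = tensorPow (u.map φ) n x y := by
  simp only [tensorPow, Matrix.of_apply, map_list_prod, List.map_ofFn]
  rfl

theorem carries_iff {V W A : Type*} [Fintype V] [CStarAlgebra A] (u : Matrix W V A) {n : ℕ}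
    (f : Tensor V n) (g : Tensor W n) :
    Carries u f g ↔
      ∀ x, ∑ y, tensorPow u n x y * algebraMap ℂ A (f y) = algebraMap ℂ A (g x) := by
  simp only [Carries, funext_iff, Matrix.mulVec, dotProduct]

/-- The relations can be tested after a jointly injective family of unital ⋆-homomorphisms. -/
theorem qutRelations_of_separating {V A : Type*} [Fintype V] [CStarAlgebra A] {I : Type*}
    {B : I → Type*} [∀ i, CStarAlgebra (B i)] (φ : ∀ i, A →⋆ₐ[ℂ] B i)
    (hφ : ∀ a b, (∀ i, φ i a = φ i b) → a = b) {S : TensorSet V} {u : Matrix V V A}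
    (h : ∀ i, QutRelations S (u.map (φ i))) : QutRelations S u where
  isQuantumPermutation :=
    { isStarProjection := fun x y =>
        ⟨hφ _ _ fun i => by
            have := ((h i).isQuantumPermutation.isStarProjection x y).isIdempotentElem.eq
            simpa using this,
          hφ _ _ fun i => by
            have := ((h i).isQuantumPermutation.isStarProjection x y).isSelfAdjoint.star_eq
            simpa [map_star] using this⟩
      row_sum := fun x => hφ _ _ fun i => by
        simpa using (h i).isQuantumPermutation.row_sum x
      col_sum := fun y => hφ _ _ fun i => by
        simpa using (h i).isQuantumPermutation.col_sum y }
  carries := fun F hF => by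
    rw [carries_iff]
    intro x
    apply hφ
    intro i
    have := (carries_iff _ _ _).1 ((h i).carries F hF) x
    simpa [map_sum, map_mul, algHom_tensorPow, AlgHomClass.commutes] using this

theorem QutRelations.map {V A B : Type*} [Fintype V] [CStarAlgebra A] [CStarAlgebra B]
    {S : TensorSet V} {u : Matrix V V A} (h : QutRelations S u) (φ : A →⋆ₐ[ℂ] B) :
    QutRelations S (u.map φ) where
  isQuantumPermutation :=
    { isStarProjection := fun x y =>
        ⟨by
            have := congrArg φ (h.isQuantumPermutation.isStarProjection x y).isIdempotentElem.eq
            simpa [IsIdempotentElem] using this,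
          by
            have := congrArg φ (h.isQuantumPermutation.isStarProjection x y).isSelfAdjoint.star_eq
            simpa [IsSelfAdjoint, map_star] using this⟩
      row_sum := fun x => by
        simpa using congrArg φ (h.isQuantumPermutation.row_sum x)
      col_sum := fun y => by
        simpa using congrArg φ (h.isQuantumPermutation.col_sum y) }
  carries := fun F hF => by
    rw [carries_iff]
    intro x
    have := congrArg φ ((carries_iff _ _ _).1 (h.carries F hF) x)
    simpa [map_sum, map_mul, algHom_tensorPow, AlgHomClass.commutes] using this

/-- The coordinate homomorphism of `C(Qut S)` at a matrix that satisfies the relations. -/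
def Qut.eval {V : Type*} [Fintype V] {S : TensorSet V} (r : QutRep S) :
    QutAlgebra S →⋆ₐ[ℂ] r.Alg where
  toFun a := a.1.1 r
  map_one' := rfl
  map_mul' _ _ := rfl
  map_zero' := rfl
  map_add' _ _ := rfl
  commutes' _ := rfl
  map_star' _ := rfl

theorem Qut.eval_fundamental {V : Type*} [Fintype V] {S : TensorSet V} (r : QutRep S) :
    (Qut.fundamental S).map (Qut.eval r) = r.mat := rfl

theorem Qut.eq_of_eval_eq {V : Type*} [Fintype V] {S : TensorSet V} (a b : QutAlgebra S)
    (h : ∀ r : QutRep S, Qut.eval r a = Qut.eval r b) : a = b :=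
  Subtype.ext (Subtype.ext (funext h))

/-- The fundamental representation satisfies the defining relations. -/
theorem Qut.relations {V : Type*} [Fintype V] (S : TensorSet V) :
    QutRelations S (Qut.fundamental S) :=
  qutRelations_of_separating (fun r : QutRep S => Qut.eval r)
    Qut.eq_of_eval_eq fun r => r.rel

/-- The entries of the fundamental representation generate a dense ⋆-subalgebra. -/
theorem Qut.dense {V : Type*} [Fintype V] (S : TensorSet V) :
    closure (StarAlgebra.adjoin ℂ
      (Set.range fun p : V × V => Qut.fundamental S p.1 p.2) : Set (QutAlgebra S)) = Set.univ := by
  rw [Set.eq_univ_iff_forall]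
  intro a
  let ι : QutAlgebra S →⋆ₐ[ℂ] QutProduct S := (qutSubalgebra S).subtype
  have h1 : (StarAlgebra.adjoin ℂ
      (Set.range fun p : V × V => Qut.fundamental S p.1 p.2)).map ι =
      StarAlgebra.adjoin ℂ (Set.range fun p : V × V => qutProductMatrix S p.1 p.2) := by
    rw [StarAlgHom.map_adjoin, ← Set.range_comp]
    rfl
  have h2 : ι a ∈ closure ((StarAlgebra.adjoin ℂ
      (Set.range fun p : V × V => qutProductMatrix S p.1 p.2) : Set (QutProduct S))) := a.2
  rw [← h1] at h2
  exact closure_subtype.2 h2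

attribute [irreducible] QutAlgebra.instCStarAlgebra

theorem small_closure_adjoin {V A : Type*} [Finite V] [CStarAlgebra A] (v : V → A) :
    Small.{0} (StarAlgebra.adjoin ℂ (Set.range v)).topologicalClosure := by
  obtain ⟨m, ⟨e⟩⟩ := Finite.exists_equiv_fin V
  let g : Fin m ⊕ Fin m → A := Sum.elim (fun i => v (e.symm i)) (fun i => star (v (e.symm i)))
  have hg : Set.range g = Set.range v ∪ star (Set.range v) := by
    ext a
    simp only [g, Set.mem_range, Sum.exists, Sum.elim_inl, Sum.elim_inr, Set.mem_union,
      Set.mem_star]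
    constructor
    · rintro (⟨i, rfl⟩ | ⟨i, rfl⟩)
      · exact Or.inl ⟨_, rfl⟩
      · exact Or.inr ⟨e.symm i, by simp⟩
    · rintro (⟨i, rfl⟩ | ⟨i, hi⟩)
      · exact Or.inl ⟨e i, by simp⟩
      · exact Or.inr ⟨e i, by simp [hi]⟩
  have h1 : Small.{0} (StarAlgebra.adjoin ℂ (Set.range v)) := by
    have hs : ∀ a ∈ StarAlgebra.adjoin ℂ (Set.range v),
        ∃ w : FreeAlgebra ℂ (Fin m ⊕ Fin m), FreeAlgebra.lift ℂ g w = a := by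
      intro a ha
      have h : a ∈ (FreeAlgebra.lift ℂ g).range := by
        rw [← Algebra.adjoin_range_eq_range_freeAlgebra_lift, hg]
        exact ha
      exact h
    choose w hw using hs
    refine small_of_injective (β := FreeAlgebra ℂ (Fin m ⊕ Fin m))
      (f := fun a : StarAlgebra.adjoin ℂ (Set.range v) => w a.1 a.2) ?_
    intro a b hab
    have h3 : w a.1 a.2 = w b.1 b.2 := hab
    exact Subtype.ext (by rw [← hw a.1 a.2, h3, hw b.1 b.2])
  have h2 : ∀ a : (StarAlgebra.adjoin ℂ (Set.range v)).topologicalClosure,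
      ∃ s : ℕ → StarAlgebra.adjoin ℂ (Set.range v),
        Filter.Tendsto (fun k => (s k : A)) Filter.atTop (nhds (a : A)) := by
    intro a
    obtain ⟨s, hs, hlim⟩ := mem_closure_iff_seq_limit.1 a.2
    exact ⟨fun k => ⟨s k, hs k⟩, hlim⟩
  choose s hs using h2
  refine small_of_injective (f := s) ?_
  intro a b hab
  refine Subtype.ext (tendsto_nhds_unique (hs a) ?_)
  rw [hab]
  exact hs b

theorem exists_small_model {C : Type*} [CStarAlgebra C] [Small.{0} C] :
    ∃ (D : Type) (_ : CStarAlgebra D) (φ : C →⋆ₐ[ℂ] D) (ψ : D →⋆ₐ[ℂ] C), ∀ c, ψ (φ c) = c := by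
  obtain ⟨D, ⟨e'⟩⟩ := Small.equiv_small.{0} (α := C)
  let e : D ≃ C := e'.symm
  let r : NormedRing (D) := e.normedRing
  let st : StarRing (D) := e.starRing
  let al : Algebra ℂ (D) := e.algebra ℂ
  have hn : ∀ x : D, ‖x‖ = ‖e x‖ := fun _ => rfl
  have hmul : ∀ x y : D, e (x * y) = e x * e y := fun _ _ => e.apply_symm_apply _
  have hadd : ∀ x y : D, e (x + y) = e x + e y := fun _ _ => e.apply_symm_apply _
  have hstar : ∀ x : D, e (star x) = star (e x) := fun _ => e.apply_symm_apply _
  have hsmul : ∀ (c : ℂ) (x : D), e (c • x) = c • e x := fun _ _ => by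
    exact e.apply_symm_apply _
  have halg : ∀ c : ℂ, e (algebraMap ℂ _ c) = algebraMap ℂ C c := fun _ => e.apply_symm_apply _
  have hone : e 1 = 1 := e.apply_symm_apply _
  have hzero : e 0 = 0 := e.apply_symm_apply _
  have hiso : Isometry e := Isometry.of_dist_eq fun _ _ => rfl
  let cs : CStarAlgebra (D) :=
    { r, st, al with
      complete := by
        have : CompleteSpace (D) :=
          (completeSpace_congr (e := e) hiso.isUniformEmbedding).2 inferInstance
        intro f hf
        exact this.complete hf
      norm_mul_self_le := fun x => by
        rw [hn, hn, hmul, hstar]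
        exact CStarRing.norm_mul_self_le (e x)
      norm_smul_le := fun c x => by
        rw [hn, hn, hsmul]
        exact norm_smul_le c (e x)
      star_smul := fun c x => e.injective (by rw [hstar, hsmul, hsmul, hstar, star_smul]) }
  let ψ : D →⋆ₐ[ℂ] C :=
    { toFun := e, map_one' := hone, map_mul' := hmul, map_zero' := hzero, map_add' := hadd,
      commutes' := halg, map_star' := hstar }
  let φ : C →⋆ₐ[ℂ] D :=
    { toFun := e.symm
      map_one' := rfl
      map_mul' := fun x y => e.injective (by rw [hmul]; simp)
      map_zero' := rfl
      map_add' := fun x y => e.injective (by rw [hadd]; simp)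
      commutes' := fun _ => rfl
      map_star' := fun x => e.injective (by rw [hstar]; simp) }
  exact ⟨D, cs, φ, ψ, fun c => e.apply_symm_apply c⟩

/-- The universal property of `C(Qut S)`: a matrix over a unital C⋆-algebra that satisfies the
defining relations is the image of the fundamental representation under a unique unital
⋆-homomorphism. -/
theorem Qut.existsUnique_hom {V : Type*} [Fintype V] (S : TensorSet V) {B : Type*}
    [CStarAlgebra B] (v : Matrix V V B) (hv : QutRelations S v) :
    ∃! φ : QutAlgebra S →⋆ₐ[ℂ] B, ∀ x y, φ (Qut.fundamental S x y) = v x y := by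
  refine existsUnique_of_exists_of_unique ?_ ?_
  · let C := (StarAlgebra.adjoin ℂ (Set.range fun p : V × V => v p.1 p.2)).topologicalClosure
    have hc : IsClosed (C : Set B) := StarSubalgebra.isClosed_topologicalClosure _
    have : Small.{0} C := small_closure_adjoin fun p : V × V => v p.1 p.2
    let vC : Matrix V V C := Matrix.of fun x y => ⟨v x y,
      StarSubalgebra.le_topologicalClosure _ (StarAlgebra.subset_adjoin ℂ _ ⟨(x, y), rfl⟩)⟩
    have hvC : QutRelations S vC :=
      qutRelations_of_separating (I := Unit) (fun _ => C.subtype)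
        (fun a b h => Subtype.ext (h ())) fun _ => hv
    obtain ⟨D, _, φ, ψ, hψφ⟩ := exists_small_model (C := C)
    rcases subsingleton_or_nontrivial D with hD | hD
    · have h1 : (1 : C) = 0 := by
        rw [← hψφ 1, ← hψφ 0, Subsingleton.elim (φ 1) (φ 0)]
      have h2 : (1 : B) = 0 := congrArg (fun c : C => (c : B)) h1
      have : Subsingleton B := subsingleton_of_zero_eq_one h2.symm
      exact ⟨{ toFun := fun _ => 0, map_one' := Subsingleton.elim _ _,
               map_mul' := fun _ _ => Subsingleton.elim _ _, map_zero' := rfl,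
               map_add' := fun _ _ => Subsingleton.elim _ _,
               commutes' := fun _ => Subsingleton.elim _ _,
               map_star' := fun _ => Subsingleton.elim _ _ },
             fun _ _ => Subsingleton.elim _ _⟩
    · let r : QutRep S := ⟨D, vC.map φ, hvC.map φ⟩
      refine ⟨C.subtype.comp (ψ.comp (Qut.eval r)), fun x y => ?_⟩
      have h := congrFun (congrFun (Qut.eval_fundamental r) x) y
      have h' : Qut.eval r (Qut.fundamental S x y) = φ (vC x y) := h
      simp only [StarAlgHom.comp_apply]
      rw [h', hψφ]
      rfl
  · intro φ ψ hφ hψ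
    have hcont : ∀ χ : QutAlgebra S →⋆ₐ[ℂ] B, Continuous χ := fun χ =>
      AddMonoidHomClass.continuous_of_bound χ 1 fun a => by
        simpa using NonUnitalStarAlgHom.norm_apply_le χ a
    have hEq : Set.EqOn φ ψ (StarAlgebra.adjoin ℂ
        (Set.range fun p : V × V => Qut.fundamental S p.1 p.2) : Set (QutAlgebra S)) := by
      have hle : StarAlgebra.adjoin ℂ (Set.range fun p : V × V => Qut.fundamental S p.1 p.2) ≤
          StarAlgHom.equalizer φ ψ := by
        apply StarAlgebra.adjoin_le
        rintro _ ⟨p, rfl⟩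
        exact (hφ p.1 p.2).trans (hψ p.1 p.2).symm
      exact hle
    have hcl := hEq.closure (hcont φ) (hcont ψ)
    rw [Qut.dense] at hcl
    exact StarAlgHom.ext fun a => hcl (Set.mem_univ a)

end

/-! Choose a representation of `Qut` in which the entry at the given points of `V` and `W` is
nonzero. Summing out the leading arguments of the projectively connected pair shows that the matrix
`u` preserves a weighted graph `Z` on `V ⊕ W` with components `V` and `W` (`Carries.sum_init`).
Hence `u a c * u b d = 0` whenever `Z a b ≠ Z c d` (`mul_eq_zero_of_ne`).

If `v` and `w` are adjacent, entries of row `v` in one column block therefore annihilate entries of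
row `w` in the other. So the sum of a row over a block agrees for neighbours, and by connectedness
it is constant on each component; the same holds for columns. Adding up a block once by rows and
once by columns then yields `|V| = |W|` and a single projection `p` that is every row and column sum
of the block with rows `W` and columns `V` (`exists_block_sum`). It is nonzero because `p` is also a
row sum of the opposite block, where it dominates the given nonzero entry.

In the corner `p A p`, whose unit is `p`, this block is a quantum permutation matrix. In the rows
indexed by `W`, `p` fixes the entries with column in `V` and kills those with column in `W`, so it
commutes with all of them. Multiplying the relation for `F i ⊕ G i`, at a tuple from `W`, by `p`
leaves only the terms indexed by tuples from `V`: the block carries `F i` to `G i`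
(`carries_of_directSum`). -/

/-! ### Corners of C⋆-algebras -/

/-- A nonzero projection `p` of a C⋆-algebra `A` is the unit of a C⋆-algebra, realized by an
injective non-unital homomorphism onto the corner `p A p`. -/
theorem exists_corner.{v} {A : Type v} [CStarAlgebra A] {p : A} (hp : IsStarProjection p)
    (hp0 : p ≠ 0) :
    ∃ (B : Type v) (_ : CStarAlgebra B) (_ : Nontrivial B) (φ : B →⋆ₙₐ[ℂ] A),
      Function.Injective φ ∧ φ 1 = p ∧ ∀ a, p * a = a → a * p = a → ∃ b, φ b = a := by
  let C : NonUnitalStarSubalgebra ℂ A :=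
    { carrier := {a | p * a = a ∧ a * p = a}
      add_mem' := fun {a b} ha hb => ⟨by rw [mul_add, ha.1, hb.1], by rw [add_mul, ha.2, hb.2]⟩
      zero_mem' := ⟨mul_zero _, zero_mul _⟩
      mul_mem' := fun {a b} ha hb =>
        ⟨by rw [← mul_assoc, ha.1], by rw [mul_assoc, hb.2]⟩
      smul_mem' := fun c a ha =>
        ⟨by rw [mul_smul_comm, ha.1], by rw [smul_mul_assoc, ha.2]⟩
      star_mem' := fun {a} ha =>
        ⟨by simpa [hp.isSelfAdjoint.star_eq] using congrArg star ha.2,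
          by simpa [hp.isSelfAdjoint.star_eq] using congrArg star ha.1⟩ }
  have hC : IsClosed (C : Set A) :=
    (isClosed_eq (by fun_prop) (by fun_prop)).inter (isClosed_eq (by fun_prop) (by fun_prop))
  -- The corner has unit `p` rather than `1`, so its inclusion into `A` is only a non-unital
  -- homomorphism.
  let e : C := ⟨p, hp.isIdempotentElem.eq, hp.isIdempotentElem.eq⟩
  let nc : NonUnitalCStarAlgebra C :=
    NonUnitalStarSubalgebra.nonUnitalCStarAlgebra C (h_closed := hC)
  let r : NormedRing C :=
    { nc with
      one := e
      one_mul := fun a => Subtype.ext a.2.1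
      mul_one := fun a => Subtype.ext a.2.2 }
  let al : NormedAlgebra ℂ C :=
    { Algebra.ofModule (fun c x y => smul_mul_assoc c x y) (fun c x y => mul_smul_comm c x y) with
      norm_smul_le := fun c x => norm_smul_le c (x : A) }
  let cs : CStarAlgebra C :=
    { r, al with
      star := star
      star_involutive := star_involutive
      star_mul := star_mul
      star_add := star_add
      complete := hC.completeSpace_coe.complete
      norm_mul_self_le := nc.norm_mul_self_le
      star_smul := fun c x => star_smul c x }
  refine ⟨C, cs, ⟨1, 0, fun h => hp0 (congrArg Subtype.val h)⟩,
    { toFun := fun a => a.1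
      map_smul' := fun _ _ => rfl
      map_zero' := rfl
      map_add' := fun _ _ => rfl
      map_mul' := fun _ _ => rfl
      map_star' := fun _ => rfl }, Subtype.val_injective, rfl, fun a h1 h2 => ⟨⟨a, h1, h2⟩, rfl⟩⟩

/-! ### Partitions of unity into projections -/

section Projections

variable {A : Type*} [CStarAlgebra A]

/-- Compressing `∑ p k = 1` by `p j` leaves `∑ p j * p k * p j = 0` over `k ≠ j`. Each term is the
positive element `star (p k * p j) * (p k * p j)`, so each vanishes, and the C⋆-identity finishes.
-/
theorem mul_eq_zero_of_sum_eq_one {I : Type*} [Fintype I] {p : I → A}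
    (hp : ∀ i, IsStarProjection (p i)) (hsum : ∑ i, p i = 1) {i j : I} (hij : i ≠ j) :
    p i * p j = 0 := by
  classical
  let _ := CStarAlgebra.spectralOrder A
  have := CStarAlgebra.spectralOrderedRing A
  have hq : ∀ k, p j * p k * p j = star (p k * p j) * (p k * p j) := fun k => by
    rw [star_mul, (hp k).isSelfAdjoint.star_eq, (hp j).isSelfAdjoint.star_eq, mul_assoc, mul_assoc,
      ← mul_assoc (p k) (p k), (hp k).isIdempotentElem.eq]
  have h1 : ∑ k ∈ Finset.univ.erase j, p j * p k * p j = 0 := by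
    have h2 : ∑ k, p j * p k * p j = p j := by
      rw [← Finset.sum_mul, ← Finset.mul_sum, hsum, mul_one, (hp j).isIdempotentElem.eq]
    rw [← Finset.add_sum_erase _ _ (Finset.mem_univ j), (hp j).isIdempotentElem.eq,
      (hp j).isIdempotentElem.eq] at h2
    simpa using h2
  have h3 := (Finset.sum_eq_zero_iff_of_nonneg (fun k _ => by
    rw [hq]; exact star_mul_self_nonneg _)).1 h1 i (by simp [hij])
  rw [hq] at h3
  exact CStarRing.star_mul_self_eq_zero_iff _ |>.1 h3

theorem isStarProjection_sum {I : Type*} {p : I → A} (hp : ∀ i, IsStarProjection (p i))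
    (horth : ∀ i j, i ≠ j → p i * p j = 0) (s : Finset I) : IsStarProjection (∑ i ∈ s, p i) where
  isIdempotentElem := by
    rw [IsIdempotentElem, Finset.sum_mul_sum]
    refine Finset.sum_congr rfl fun i hi => ?_
    rw [Finset.sum_eq_single_of_mem i hi fun j _ hj => horth i j hj.symm,
      (hp i).isIdempotentElem.eq]
  isSelfAdjoint := by
    rw [isSelfAdjoint_iff, star_sum]
    exact Finset.sum_congr rfl fun i _ => (hp i).isSelfAdjoint.star_eq

end Projections

/-! ### Quantum permutation matrices and the graphs they preserve -/

namespace IsQuantumPermutation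

variable {V W A : Type*} [Fintype V] [Fintype W] [CStarAlgebra A] {u : Matrix W V A}

theorem transpose (hu : IsQuantumPermutation u) : IsQuantumPermutation u.transpose where
  isStarProjection i j := hu.isStarProjection j i
  row_sum := hu.col_sum
  col_sum := hu.row_sum

theorem mul_self (hu : IsQuantumPermutation u) (i : W) (j : V) : u i j * u i j = u i j :=
  (hu.isStarProjection i j).isIdempotentElem.eq

theorem row_orthogonal (hu : IsQuantumPermutation u) (i : W) {j k : V} (hjk : j ≠ k) :
    u i j * u i k = 0 :=
  mul_eq_zero_of_sum_eq_one (fun j => hu.isStarProjection i j) (hu.row_sum i) hjk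

theorem sum_tensorPow (hu : IsQuantumPermutation u) (k : ℕ) (y : Fin k → V) :
    ∑ x, tensorPow u k x y = 1 := by
  induction k with
  | zero => simp [tensorPow]
  | succ k ih =>
    rw [← (Fin.consEquiv fun _ : Fin (k + 1) => W).sum_comp, Fintype.sum_prod_type]
    have h : ∀ (a : W) (x : Fin k → W), tensorPow u (k + 1) (Fin.consEquiv (fun _ => W) (a, x)) y =
        u a (y 0) * tensorPow u k x (fun j => y j.succ) := fun a x => by
      simp [tensorPow, Fin.consEquiv, List.ofFn_succ]
    simp only [h, ← Finset.mul_sum, ih, mul_one, hu.col_sum]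

/-- Entries of a quantum permutation matrix commuting with `X` are orthogonal when `X` takes
different values. -/
theorem mul_eq_zero_of_ne (hu : IsQuantumPermutation u) {X : V → V → ℂ} {Y : W → W → ℂ}
    (hX : ∀ a b, ∑ c, ∑ d, u a c * u b d * algebraMap ℂ A (X c d) = algebraMap ℂ A (Y a b))
    {a b : W} {c d : V} (hne : Y a b ≠ X c d) : u a c * u b d = 0 := by
  classical
  -- Expand `Y a b` in the middle by `hX`: orthogonality in rows `a` and `b` leaves only the term
  -- `(c, d)`.
  have h1 : u a c * algebraMap ℂ A (Y a b) * u b d = u a c * u b d * algebraMap ℂ A (X c d) := by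
    rw [← hX, Finset.mul_sum, Finset.sum_mul, Finset.sum_eq_single c]
    · rw [Finset.mul_sum, Finset.sum_mul, Finset.sum_eq_single d]
      · rw [mul_assoc, mul_assoc (u a c * u b d), Algebra.commutes _ (u b d), ← mul_assoc,
          ← mul_assoc, ← mul_assoc, hu.mul_self, mul_assoc (u a c), hu.mul_self]
      · intro d' _ hd
        rw [mul_assoc, mul_assoc (_ * _), Algebra.commutes _ (u b d), mul_assoc (u a c),
          ← mul_assoc (u b d'), hu.row_orthogonal b hd]
        simp
      · simp
    · intro c' _ hc
      rw [Finset.mul_sum, Finset.sum_mul]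
      refine Finset.sum_eq_zero fun d' _ => ?_
      rw [← mul_assoc, ← mul_assoc, hu.row_orthogonal a hc.symm]
      simp
    · simp
  rw [← Algebra.commutes, mul_assoc, ← Algebra.commutes _ (u a c * u b d), ← sub_eq_zero,
    ← sub_mul, ← map_sub, ← Algebra.smul_def] at h1
  exact (smul_eq_zero.1 h1).resolve_left (sub_ne_zero.2 hne)

end IsQuantumPermutation

/-- A quantum permutation matrix that fixes `H` fixes the sums of `H` over all but the last two
arguments. -/
theorem Carries.sum_init {V W A : Type*} [Fintype V] [Fintype W] [CStarAlgebra A]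
    {u : Matrix W V A} (hu : IsQuantumPermutation u) {k : ℕ} {H : Tensor V (k + 2)}
    {K : Tensor W (k + 2)} (h : Carries u H K) (a b : W) :
    ∑ c, ∑ d, u a c * u b d * algebraMap ℂ A (projectedGraph H c d) =
      algebraMap ℂ A (projectedGraph K a b) := by
  rw [carries_iff] at h
  have hpow : ∀ (x : Fin k → W) (y : Fin k → V) (c d : V),
      tensorPow u (k + 2) (Fin.append x ![a, b]) (Fin.append y ![c, d]) =
        tensorPow u k x y * (u a c * u b d) := fun x y c d => by
    have : (fun i => u (Fin.append x ![a, b] i) (Fin.append y ![c, d] i)) =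
        Fin.append (fun i => u (x i) (y i)) ![u a c, u b d] := by
      funext i
      refine Fin.addCases (fun i => ?_) (fun i => ?_) i
      · simp
      · fin_cases i <;> simp [Fin.append_right]
    simp only [tensorPow, Matrix.of_apply]
    rw [this, List.ofFn_fin_append, List.prod_append]
    simp
  have hsplit : ∀ x : Fin k → W, algebraMap ℂ A (K (Fin.append x ![a, b])) =
      ∑ y : Fin k → V, ∑ c, ∑ d, tensorPow u k x y * (u a c * u b d) *
        algebraMap ℂ A (H (Fin.append y ![c, d])) := fun x => by
    rw [← h, ← (Fin.appendEquiv k 2).sum_comp, Fintype.sum_prod_type]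
    refine Finset.sum_congr rfl fun y _ => ?_
    rw [← (finTwoArrowEquiv V).symm.sum_comp, Fintype.sum_prod_type]
    refine Finset.sum_congr rfl fun c _ => Finset.sum_congr rfl fun d _ => ?_
    rw [← hpow]
    rfl
  simp only [projectedGraph, Matrix.of_apply, map_sum]
  simp only [hsplit]
  -- Move the sum over `x` innermost, where `∑ x, tensorPow u k x y = 1` removes the leading
  -- factors.
  refine Eq.trans ?_ Finset.sum_comm
  simp only [Finset.mul_sum]
  refine ((Finset.sum_congr rfl fun c _ => Finset.sum_comm).trans Finset.sum_comm).trans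
    (Finset.sum_congr rfl fun y _ => ?_)
  refine Eq.trans (Finset.sum_congr rfl fun c _ => ?_) Finset.sum_comm
  refine Eq.trans (Finset.sum_congr rfl fun d _ => ?_) Finset.sum_comm
  rw [← Finset.sum_mul, ← Finset.sum_mul, hu.sum_tensorPow, one_mul]

/-! ### Connected graphs -/

/-- Otherwise the level set of `f` through `w` and its complement would disconnect `X`. -/
theorem eq_of_not_isDisconnected {V B : Type*} {X : Matrix V V ℂ} (hX : ¬ IsDisconnected X)
    {f : V → B} (hf : ∀ v w, X v w ≠ 0 → f v = f w) (v w : V) : f v = f w := by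
  by_contra hne
  refine hX ⟨{x | f x = f w}, {x | f x ≠ f w}, ⟨w, rfl⟩, ⟨v, hne⟩, ?_, ?_, fun x y hxy => ?_⟩
  · ext x; simp
  · ext x; simpa using em _
  · by_contra h
    have := hf x y h
    by_cases hx : f x = f w
    · exact hxy (Or.inl ⟨hx, this.symm.trans hx⟩)
    · exact hxy (Or.inr ⟨hx, fun hy => hx (this.trans hy)⟩)

/-- Complementary pairs indexed by the vertices of a connected graph are constant if neighbouring
pairs are orthogonal crosswise. -/
theorem eq_of_cross_orthogonal {V A : Type*} [Ring A] {X : Matrix V V ℂ} (hX : ¬ IsDisconnected X)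
    {α β : V → A} (hsum : ∀ v, α v + β v = 1)
    (h1 : ∀ v w, X v w ≠ 0 → α v * β w = 0) (h2 : ∀ v w, X v w ≠ 0 → β v * α w = 0) (v w : V) :
    α v = α w := by
  refine eq_of_not_isDisconnected hX (fun v w h => ?_) v w
  calc α v = α v * (α w + β w) := by rw [hsum, mul_one]
    _ = (α v + β v) * α w := by rw [mul_add, add_mul, h1 v w h, h2 v w h]
    _ = α w := by rw [hsum, one_mul]

/-! ### Direct sums -/

section DirectSum

variable {V W : Type*} {n : ℕ} (F : Tensor V n) (G : Tensor W n)

theorem blockSum_inl (z : Fin n → V) : blockSum F G (fun k => Sum.inl (z k)) = F z := by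
  simp [blockSum]

/-- The empty tuple satisfies both case conditions and the definition then selects `F`, so arity
zero is excluded. -/
theorem blockSum_inr (hn : n ≠ 0) (z : Fin n → W) :
    blockSum F G (fun k => Sum.inr (z k)) = G z := by
  have : ¬ ∀ k : Fin n, (Sum.inr (z k) : V ⊕ W).isLeft := fun h => by
    simpa using h ⟨0, Nat.pos_of_ne_zero hn⟩
  simp only [blockSum, dif_neg this]
  simp

theorem blockSum_eq_zero {z : Fin n → V ⊕ W} {i j : Fin n} (hi : (z i).isLeft)
    (hj : (z j).isRight) : blockSum F G z = 0 := by
  have h1 : ¬ ∀ k, (z k).isLeft := fun h => by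
    have := h j
    cases h' : z j <;> simp_all
  have h2 : ¬ ∀ k, (z k).isRight := fun h => by
    have := h i
    cases h' : z i <;> simp_all
  simp only [blockSum, dif_neg h1, dif_neg h2]

end DirectSum

theorem sum_arrow_inl {V W M : Type*} [Fintype V] [Fintype W] [AddCommMonoid M] {n : ℕ}
    (f : (Fin n → V ⊕ W) → M) (hf : ∀ z, (∃ k, (z k).isRight) → f z = 0) :
    ∑ z, f z = ∑ y : Fin n → V, f fun k => Sum.inl (y k) := by
  symm
  refine Finset.sum_of_injOn (fun y k => Sum.inl (y k)) ?_ (by simp) ?_ (by simp)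
  · intro y _ y' _ h
    funext k
    exact Sum.inl_injective (congrFun h k)
  · intro z _ hz
    apply hf
    by_contra hcon
    push Not at hcon
    have hl : ∀ k, ∃ v, z k = Sum.inl v := fun k => by
      have := hcon k
      cases h : z k <;> simp_all
    choose y hy using hl
    exact hz ⟨y, by simp, funext fun k => (hy k).symm⟩

theorem sum_arrow_inr {V W M : Type*} [Fintype V] [Fintype W] [AddCommMonoid M] {n : ℕ}
    (f : (Fin n → V ⊕ W) → M) (hf : ∀ z, (∃ k, (z k).isLeft) → f z = 0) :
    ∑ z, f z = ∑ y : Fin n → W, f fun k => Sum.inr (y k) := by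
  rw [← (Equiv.arrowCongr (Equiv.refl (Fin n)) (Equiv.sumComm W V)).sum_comp, sum_arrow_inl]
  · rfl
  · rintro z ⟨k, hk⟩
    refine hf _ ⟨k, ?_⟩
    have : (Equiv.arrowCongr (Equiv.refl (Fin n)) (Equiv.sumComm W V)) z k = (z k).swap := rfl
    rw [this, Sum.isLeft_swap, hk]

/-! ### The projected graph of a direct sum -/

section ProjectedGraph

variable {V W : Type*} [Fintype V] [Fintype W] {k : ℕ} (F : Tensor V (k + 2)) (G : Tensor W (k + 2))

theorem append_pair_inl {V W : Type*} {k : ℕ} (x : Fin k → V) (v w : V) :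
    Fin.append (fun i => (Sum.inl (x i) : V ⊕ W)) ![Sum.inl v, Sum.inl w] =
      fun i => Sum.inl (Fin.append x ![v, w] i) := by
  funext i
  refine Fin.addCases (fun i => ?_) (fun i => ?_) i
  · simp
  · fin_cases i <;> simp [Fin.append_right]

theorem append_pair_inr {V W : Type*} {k : ℕ} (x : Fin k → W) (v w : W) :
    Fin.append (fun i => (Sum.inr (x i) : V ⊕ W)) ![Sum.inr v, Sum.inr w] =
      fun i => Sum.inr (Fin.append x ![v, w] i) := by
  funext i
  refine Fin.addCases (fun i => ?_) (fun i => ?_) i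
  · simp
  · fin_cases i <;> simp [Fin.append_right]

theorem projectedGraph_blockSum_inl (v w : V) :
    projectedGraph (blockSum F G) (Sum.inl v) (Sum.inl w) = projectedGraph F v w := by
  simp only [projectedGraph, Matrix.of_apply]
  rw [sum_arrow_inl]
  · simp only [append_pair_inl, blockSum_inl]
  · rintro z ⟨j, hj⟩
    exact blockSum_eq_zero F G (i := Fin.natAdd k 0) (j := Fin.castAdd 2 j) (by simp) (by simpa)

theorem projectedGraph_blockSum_inr (v w : W) :
    projectedGraph (blockSum F G) (Sum.inr v) (Sum.inr w) = projectedGraph G v w := by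
  simp only [projectedGraph, Matrix.of_apply]
  rw [sum_arrow_inr]
  · simp only [append_pair_inr, blockSum_inr F G (Nat.succ_ne_zero _)]
  · rintro z ⟨j, hj⟩
    exact blockSum_eq_zero F G (i := Fin.castAdd 2 j) (j := Fin.natAdd k 0) (by simpa) (by simp)

theorem projectedGraph_blockSum_inl_inr (v : V) (w : W) :
    projectedGraph (blockSum F G) (Sum.inl v) (Sum.inr w) = 0 :=
  Finset.sum_eq_zero fun _ _ =>
    blockSum_eq_zero F G (i := Fin.natAdd k 0) (j := Fin.natAdd k 1) (by simp) (by simp)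

theorem projectedGraph_blockSum_inr_inl (v : V) (w : W) :
    projectedGraph (blockSum F G) (Sum.inr w) (Sum.inl v) = 0 :=
  Finset.sum_eq_zero fun _ _ =>
    blockSum_eq_zero F G (i := Fin.natAdd k 1) (j := Fin.natAdd k 0) (by simp) (by simp)

end ProjectedGraph

/-! ### Row and column sums of the blocks -/

/-- Squaring gives `m² p = k² r = m k p`, so `m = k`. This turns a double count of a block into
equality of the two domain sizes. -/
theorem eq_of_smul_idempotent {A : Type*} [CStarAlgebra A] {p r : A} (hp : p * p = p)
    (hr : r * r = r) (hp0 : p ≠ 0) {m k : ℕ} (hm : m ≠ 0) (h : (m : ℂ) • p = (k : ℂ) • r) :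
    m = k ∧ p = r := by
  have hm' : (m : ℂ) ≠ 0 := Nat.cast_ne_zero.2 hm
  have h1 : ((m : ℂ) * m) • p = ((m : ℂ) * k) • p := by
    have h2 : ((m : ℂ) • p) * ((m : ℂ) • p) = ((k : ℂ) • r) * ((k : ℂ) • r) := by rw [h]
    rw [smul_mul_smul_comm, smul_mul_smul_comm, hp, hr, mul_smul (k : ℂ) k r, ← h, smul_smul] at h2
    rw [h2, mul_comm]
  have h3 : m = k := by
    rw [← sub_eq_zero, ← sub_smul, ← mul_sub] at h1
    have := (mul_eq_zero.1 ((smul_eq_zero.1 h1).resolve_right hp0)).resolve_left hm'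
    exact_mod_cast sub_eq_zero.1 this
  subst h3
  exact ⟨rfl, (smul_right_injective A hm') h⟩

/-- The sums of a row over the two column blocks are complementary, so `eq_of_cross_orthogonal`
applies. The embedding `e` allows use for both components, and for columns through the transpose. -/
theorem sum_block_eq_of_connected {V C D R A : Type*} [Fintype C] [Fintype D] [Fintype R]
    [CStarAlgebra A] {u : Matrix R (C ⊕ D) A} (hu : IsQuantumPermutation u) (e : V → R)
    {X : Matrix V V ℂ} (hX : ¬ IsDisconnected X)
    (h1 : ∀ v w, X v w ≠ 0 → ∀ c d, u (e v) (Sum.inl c) * u (e w) (Sum.inr d) = 0)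
    (h2 : ∀ v w, X v w ≠ 0 → ∀ c d, u (e v) (Sum.inr d) * u (e w) (Sum.inl c) = 0) (v w : V) :
    ∑ c, u (e v) (Sum.inl c) = ∑ c, u (e w) (Sum.inl c) := by
  refine eq_of_cross_orthogonal hX (α := fun v => ∑ c, u (e v) (Sum.inl c))
    (β := fun v => ∑ d, u (e v) (Sum.inr d)) (fun v => ?_) (fun v w h => ?_) (fun v w h => ?_) v w
  · simpa using hu.row_sum (e v)
  · simp [Finset.sum_mul_sum, h1 v w h]
  · simp [Finset.sum_mul_sum, h2 v w h]

/-- If a quantum permutation matrix preserves a graph with two connected components `V` and `W` and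
does not respect the components, then these have the same size and all rows and columns of the
off-diagonal blocks have the same sum, a nonzero projection. -/
theorem exists_block_sum {V W A : Type*} [Fintype V] [Fintype W] [CStarAlgebra A]
    {u : Matrix (V ⊕ W) (V ⊕ W) A} (hu : IsQuantumPermutation u) {Z : Matrix (V ⊕ W) (V ⊕ W) ℂ}
    (hZ : ∀ a b c d, Z a b ≠ Z c d → u a c * u b d = 0)
    (hV : ¬ IsDisconnected (Z.submatrix Sum.inl Sum.inl))
    (hW : ¬ IsDisconnected (Z.submatrix Sum.inr Sum.inr))
    (hVW : ∀ v w, Z (Sum.inl v) (Sum.inr w) = 0) (hWV : ∀ v w, Z (Sum.inr w) (Sum.inl v) = 0)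
    {x : V} {y : W} (hxy : u (Sum.inl x) (Sum.inr y) ≠ 0) :
    Fintype.card V = Fintype.card W ∧ ∃ p : A, IsStarProjection p ∧ p ≠ 0 ∧
      (∀ w, ∑ v, u (Sum.inr w) (Sum.inl v) = p) ∧ ∀ v, ∑ w, u (Sum.inr w) (Sum.inl v) = p := by
  have hrow : ∀ a b c d, Z a b ≠ 0 → Z c d = 0 → u a c * u b d = 0 := fun a b c d h h' =>
    hZ a b c d (by rwa [h'])
  have hcol : ∀ a b c d, Z a b ≠ 0 → Z c d = 0 → u c a * u d b = 0 := fun a b c d h h' =>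
    hZ c d a b (by rw [h']; exact h.symm)
  have rowV := sum_block_eq_of_connected hu Sum.inl hV
    (fun v w h c d => hrow _ _ _ _ h (hVW _ _)) (fun v w h c d => hrow _ _ _ _ h (hWV _ _))
  have rowW := sum_block_eq_of_connected hu Sum.inr hW
    (fun v w h c d => hrow _ _ _ _ h (hVW _ _)) (fun v w h c d => hrow _ _ _ _ h (hWV _ _))
  have colV := sum_block_eq_of_connected hu.transpose Sum.inl hV
    (fun v w h c d => hcol _ _ _ _ h (hVW _ _)) (fun v w h c d => hcol _ _ _ _ h (hWV _ _))
  have colW := sum_block_eq_of_connected hu.transpose Sum.inr hW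
    (fun v w h c d => hcol _ _ _ _ h (hVW _ _)) (fun v w h c d => hcol _ _ _ _ h (hWV _ _))
  simp only [Matrix.transpose_apply] at colV colW
  have splitRow : ∀ a, ∑ v, u a (Sum.inl v) + ∑ w, u a (Sum.inr w) = 1 := fun a => by
    simpa using hu.row_sum a
  have splitCol : ∀ a, ∑ v, u (Sum.inl v) a + ∑ w, u (Sum.inr w) a = 1 := fun a => by
    simpa using hu.col_sum a
  have rowV' : ∀ v, ∑ w, u (Sum.inl v) (Sum.inr w) = ∑ w, u (Sum.inl x) (Sum.inr w) := fun v => by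
    rw [eq_sub_iff_add_eq'.2 (splitRow (Sum.inl v)), rowV v x,
      ← eq_sub_iff_add_eq'.2 (splitRow (Sum.inl x))]
  have colV' : ∀ v, ∑ w, u (Sum.inr w) (Sum.inl v) = ∑ w, u (Sum.inr w) (Sum.inl x) := fun v => by
    rw [eq_sub_iff_add_eq'.2 (splitCol (Sum.inl v)), colV v x,
      ← eq_sub_iff_add_eq'.2 (splitCol (Sum.inl x))]
  -- `p` and `r` are the row and column sums of the block `V × W`; `q` and `s` are those of `W × V`.
  set p := ∑ w, u (Sum.inl x) (Sum.inr w) with hpdef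
  set q := ∑ v, u (Sum.inr y) (Sum.inl v) with hqdef
  set r := ∑ v, u (Sum.inl v) (Sum.inr y) with hrdef
  set s := ∑ w, u (Sum.inr w) (Sum.inl x) with hsdef
  have hp : IsStarProjection p := isStarProjection_sum (fun w => hu.isStarProjection _ _)
    (fun i j hij => hu.row_orthogonal _ (Sum.inr_injective.ne hij)) _
  have hr : IsStarProjection r := isStarProjection_sum (fun w => hu.isStarProjection _ _)
    (fun i j hij => hu.transpose.row_orthogonal _ (Sum.inl_injective.ne hij)) _
  -- The nonzero entry at `(x, y)` is a summand of `p` and is absorbed by it.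
  have hp0 : p ≠ 0 := fun h => hxy (by
    have h1 : u (Sum.inl x) (Sum.inr y) * p = u (Sum.inl x) (Sum.inr y) := by
      rw [hpdef, Finset.mul_sum, Finset.sum_eq_single_of_mem y (Finset.mem_univ y), hu.mul_self]
      exact fun w _ hw => hu.row_orthogonal _ (Sum.inr_injective.ne hw.symm)
    rw [← h1, h, mul_zero])
  have hV0 : Fintype.card V ≠ 0 := (Fintype.card_pos_iff.2 ⟨x⟩).ne'
  have hVC : (Fintype.card V : ℂ) ≠ 0 := Nat.cast_ne_zero.2 hV0
  have hpr : (Fintype.card V : ℂ) • p = (Fintype.card W : ℂ) • r := by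
    calc (Fintype.card V : ℂ) • p = ∑ v, ∑ w, u (Sum.inl v) (Sum.inr w) := by
          simp [rowV', Nat.cast_smul_eq_nsmul]
      _ = ∑ w, ∑ v, u (Sum.inl v) (Sum.inr w) := Finset.sum_comm
      _ = (Fintype.card W : ℂ) • r := by
          simp [fun w => colW w y, hrdef, Nat.cast_smul_eq_nsmul]
  obtain ⟨hcard, -⟩ := eq_of_smul_idempotent hp.isIdempotentElem.eq hr.isIdempotentElem.eq hp0
    hV0 hpr
  have hqs : (Fintype.card V : ℂ) • q = (Fintype.card V : ℂ) • s := by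
    calc (Fintype.card V : ℂ) • q = ∑ w, ∑ v, u (Sum.inr w) (Sum.inl v) := by
          simp [fun w => rowW w y, hqdef, hcard, Nat.cast_smul_eq_nsmul]
      _ = ∑ v, ∑ w, u (Sum.inr w) (Sum.inl v) := Finset.sum_comm
      _ = (Fintype.card V : ℂ) • s := by simp [colV', Nat.cast_smul_eq_nsmul]
  -- The diagonal block `V × V` links the two off-diagonal blocks: its row sums are `1 - p` and its
  -- column sums `1 - s`.
  have hps : (Fintype.card V : ℂ) • (1 - p) = (Fintype.card V : ℂ) • (1 - s) := by
    calc (Fintype.card V : ℂ) • (1 - p) = ∑ v, ∑ w, u (Sum.inl v) (Sum.inl w) := by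
          simp [fun v => eq_sub_iff_add_eq.2 (splitRow (Sum.inl v)), rowV', Nat.cast_smul_eq_nsmul, mul_sub]
      _ = ∑ w, ∑ v, u (Sum.inl v) (Sum.inl w) := Finset.sum_comm
      _ = (Fintype.card V : ℂ) • (1 - s) := by
          simp [fun v => eq_sub_iff_add_eq.2 (splitCol (Sum.inl v)), colV', Nat.cast_smul_eq_nsmul, mul_sub]
  have hqs' : q = s := smul_right_injective A hVC hqs
  have hps' : p = s := sub_right_injective (smul_right_injective A hVC hps)
  exact ⟨hcard, p, hp, hp0, fun w => (rowW w y).trans (hqs'.trans hps'.symm),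
    fun v => (colV' v).trans hps'.symm⟩

/-! ### Passing to the corner -/

/-- The factor `φ 1` accounts for the empty product, since `φ` need not preserve the unit; otherwise
it is absorbed. -/
theorem map_list_prod_of_corner {A B : Type*} [CStarAlgebra A] [CStarAlgebra B]
    (φ : B →⋆ₙₐ[ℂ] A) (l : List B) : φ l.prod = φ 1 * (l.map φ).prod := by
  induction l with
  | nil => simp
  | cons b l ih =>
    rw [List.prod_cons, map_mul, ih, List.map_cons, List.prod_cons, ← mul_assoc, ← mul_assoc,
      ← map_mul, ← map_mul, mul_one, one_mul]

theorem List.mul_prod_eq_zero {A : Type*} [Ring A] {p : A} {l : List A}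
    (hp : ∀ a ∈ l, p * a = a * p) {a : A} (ha : a ∈ l) (h0 : p * a = 0) : p * l.prod = 0 := by
  induction l with
  | nil => simp at ha
  | cons b l ih =>
    rw [List.prod_cons]
    rcases List.mem_cons.1 ha with rfl | ha
    · rw [← mul_assoc, h0, zero_mul]
    · rw [← mul_assoc, hp b (by simp), mul_assoc, ih (fun a h => hp a (by simp [h])) ha, mul_zero]

theorem map_mul_algebraMap_of_corner {A B : Type*} [CStarAlgebra A] [CStarAlgebra B]
    (φ : B →⋆ₙₐ[ℂ] A) (b : B) (c : ℂ) : φ (b * algebraMap ℂ B c) = φ b * algebraMap ℂ A c := by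
  rw [← Algebra.commutes, ← Algebra.smul_def, map_smul, ← Algebra.commutes, ← Algebra.smul_def]

/-- An off-diagonal block that is cut out by a projection carries `F` to `G` if the whole matrix
fixes their direct sum. -/
theorem carries_of_directSum {V W A B : Type*} [Fintype V] [Fintype W] [CStarAlgebra A]
    [CStarAlgebra B] {u : Matrix (V ⊕ W) (V ⊕ W) A} (hu : IsQuantumPermutation u)
    {φ : B →⋆ₙₐ[ℂ] A} (hφ : Function.Injective φ)
    (hl : ∀ w v, φ 1 * u (Sum.inr w) (Sum.inl v) = u (Sum.inr w) (Sum.inl v))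
    (hr : ∀ w w', φ 1 * u (Sum.inr w) (Sum.inr w') = 0)
    (hcomm : ∀ w a, φ 1 * u (Sum.inr w) a = u (Sum.inr w) a * φ 1)
    {m : Matrix W V B} (hm : ∀ w v, φ (m w v) = u (Sum.inr w) (Sum.inl v))
    {n : ℕ} (hn : 1 ≤ n) (F : Tensor V n) (G : Tensor W n)
    (h : Carries u (directSum n F G).2 (directSum n F G).2) : Carries m F G := by
  have hone : ∀ c : ℂ, φ (algebraMap ℂ B c) = φ 1 * algebraMap ℂ A c := fun c => by
    rw [← map_mul_algebraMap_of_corner, one_mul]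
  rw [carries_iff]
  intro x
  apply hφ
  simp only [map_sum, map_mul_algebraMap_of_corner]
  rw [hone]
  match n, hn with
  | 1, _ =>
    -- At a diagonal pair only diagonal terms survive: `unarySum` vanishes elsewhere, and `u * u =
    -- u` entrywise makes the relation linear in `u`.
    have h1 := (carries_iff u (unarySum F G) (unarySum F G)).1 h ![Sum.inr (x 0), Sum.inr (x 0)]
    have h2 : ∑ a, u (Sum.inr (x 0)) a *
        algebraMap ℂ A (Sum.elim (fun v => F ![v]) (fun w => G ![w]) a) =
        algebraMap ℂ A (G ![x 0]) := by
      have h3 : unarySum F G ![Sum.inr (x 0), Sum.inr (x 0)] = G ![x 0] := by simp [unarySum]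
      refine Eq.trans ?_ (h1.trans (congrArg _ h3))
      rw [← (finTwoArrowEquiv (V ⊕ W)).symm.sum_comp, Fintype.sum_prod_type]
      refine Finset.sum_congr rfl fun a _ => ?_
      rw [Finset.sum_eq_single_of_mem a (Finset.mem_univ a)]
      · simp [tensorPow, unarySum, finTwoArrowEquiv, hu.mul_self]
      · intro b _ hb
        simp [unarySum, finTwoArrowEquiv, hb.symm]
    have hx : x = ![x 0] := by ext i; fin_cases i; rfl
    rw [hx, ← h2, Fintype.sum_sum_type, mul_add, Finset.mul_sum, Finset.mul_sum,
      ← (Equiv.funUnique (Fin 1) V).symm.sum_comp]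
    simp only [← mul_assoc, hl, hr, zero_mul, Finset.sum_const_zero, add_zero]
    refine Finset.sum_congr rfl fun v _ => ?_
    have hv : (Equiv.funUnique (Fin 1) V).symm v = ![v] := by ext i; fin_cases i; rfl
    rw [hv]
    simp [tensorPow, hm]
  | k + 2, _ =>
    have h1 := (carries_iff u (blockSum F G) (blockSum F G)).1 h fun i => Sum.inr (x i)
    rw [blockSum_inr F G (Nat.succ_ne_zero _)] at h1
    rw [← h1, Finset.mul_sum, sum_arrow_inl]
    · refine Finset.sum_congr rfl fun y _ => ?_
      rw [blockSum_inl, ← mul_assoc]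
      congr 1
      simp only [tensorPow, Matrix.of_apply, map_list_prod_of_corner, List.map_ofFn]
      congr 3
      funext i
      exact hm _ _
    -- A column index in `W` gives a factor killed by `φ 1`, which commutes past the factors before
    -- it.
    · rintro z ⟨i, hi⟩
      obtain ⟨w, hw⟩ := Sum.isRight_iff.1 hi
      rw [← mul_assoc, tensorPow, Matrix.of_apply, List.mul_prod_eq_zero ?_
        ((List.mem_ofFn' _ _).2 ⟨i, rfl⟩) ?_, zero_mul]
      · intro a ha
        obtain ⟨j, rfl⟩ := (List.mem_ofFn' _ _).1 ha
        exact hcomm _ _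
      · rw [hw, hr]

/-! ### The main theorem -/

theorem mainTheorem6 {V W ι : Type*} [Fintype V] [Fintype W]
    (n : ι → ℕ) (hn : ∀ i, 1 ≤ n i)
    (F : ∀ i, Tensor V (n i)) (G : ∀ i, Tensor W (n i))
    (hF : ConjClosed (tensorSet F)) (hG : ConjClosed (tensorSet G))
    (hconn : ∃ i, ProjectivelyConnected (F i) ∧ ProjectivelyConnected (G i))
    (horbit : ∃ (x : V) (y : W), Qut.SameOrbit (directSumSet F G) (Sum.inl x) (Sum.inr y)) :
    QuantumIsomorphic F G := by
  obtain ⟨x, y, hxy⟩ := horbit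
  -- A nonzero element of `C(Qut)` has a nonzero coordinate, and this supplies a concrete nonzero
  -- algebra in `Type`.
  obtain ⟨r, hr⟩ : ∃ r : QutRep (directSumSet F G), r.mat (Sum.inl x) (Sum.inr y) ≠ 0 := by
    by_contra! hcon
    exact hxy (Qut.eq_of_eval_eq _ _ fun r => (hcon r).trans (map_zero (Qut.eval r)).symm)
  have hu := r.rel.isQuantumPermutation
  have hcar : ∀ i, Carries r.mat (directSum (n i) (F i) (G i)).2 (directSum (n i) (F i) (G i)).2 :=
    fun i => r.rel.carries _ ⟨i, rfl⟩
  obtain ⟨i, hFi, hGi⟩ := hconn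
  obtain ⟨hcard, p, hp, hp0, hrow, hcol⟩ : Fintype.card V = Fintype.card W ∧
      ∃ p : r.Alg, IsStarProjection p ∧ p ≠ 0 ∧
        (∀ w, ∑ v, r.mat (Sum.inr w) (Sum.inl v) = p) ∧
        ∀ v, ∑ w, r.mat (Sum.inr w) (Sum.inl v) = p := by
    have hi := hcar i
    -- Freeing the arity allows matching on it; projective connectivity is `False` in arities 0 and
    -- 1.
    generalize F i = f at *
    generalize G i = g at *
    generalize n i = k at *
    match k, f, g, hFi, hGi, hi with
    | k + 2, f, g, hf, hg, hi =>
      have hX := Carries.sum_init hu (H := blockSum f g) (K := blockSum f g) hi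
      refine exists_block_sum hu (fun a b c d h => hu.mul_eq_zero_of_ne hX h) ?_ ?_
        (projectedGraph_blockSum_inl_inr f g) (projectedGraph_blockSum_inr_inl f g) hr
      · rwa [show (projectedGraph (blockSum f g)).submatrix Sum.inl Sum.inl = projectedGraph f from
          Matrix.ext fun v w => projectedGraph_blockSum_inl f g v w]
      · rwa [show (projectedGraph (blockSum f g)).submatrix Sum.inr Sum.inr = projectedGraph g from
          Matrix.ext fun v w => projectedGraph_blockSum_inr f g v w]
  have hl : ∀ w v, p * r.mat (Sum.inr w) (Sum.inl v) = r.mat (Sum.inr w) (Sum.inl v) :=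
    fun w v => by
      rw [← hrow w, Finset.sum_mul, Finset.sum_eq_single_of_mem v (Finset.mem_univ v), hu.mul_self]
      exact fun v' _ h => hu.row_orthogonal _ (Sum.inl_injective.ne h)
  have hz : ∀ w w', p * r.mat (Sum.inr w) (Sum.inr w') = 0 := fun w w' => by
    rw [← hrow w, Finset.sum_mul]
    exact Finset.sum_eq_zero fun v _ => hu.row_orthogonal _ Sum.inl_ne_inr
  have hcomm : ∀ w a, p * r.mat (Sum.inr w) a = r.mat (Sum.inr w) a * p := fun w a => by
    -- A product of two projections that is self-adjoint commutes; here it is either the entry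
    -- itself or zero.
    have hsa : IsSelfAdjoint (p * r.mat (Sum.inr w) a) := by
      rcases a with v | w'
      · rw [hl]; exact (hu.isStarProjection _ _).isSelfAdjoint
      · rw [hz]; exact .zero _
    have h := hsa.star_eq
    rw [star_mul, hp.isSelfAdjoint.star_eq,
      (hu.isStarProjection (Sum.inr w) a).isSelfAdjoint.star_eq] at h
    exact h.symm
  obtain ⟨B, _, hB, φ, hφ, hφ1, hsurj⟩ := exists_corner hp hp0
  choose m hm using fun w v => hsurj _ (hl w v) ((hcomm w _).symm.trans (hl w v))
  refine ⟨hcard, B, inferInstance, hB, m,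
    ⟨fun w v => ⟨hφ ?_, hφ ?_⟩, fun w => hφ ?_, fun v => hφ ?_⟩, fun i => ?_⟩
  · rw [map_mul, hm, hu.mul_self]
  · rw [map_star, hm, (hu.isStarProjection _ _).isSelfAdjoint.star_eq]
  · simp only [map_sum, hm, hrow, hφ1]
  · simp only [map_sum, hm, hcol, hφ1]
  · exact carries_of_directSum hu hφ (by rwa [hφ1]) (by rwa [hφ1]) (by rwa [hφ1]) hm (hn i) _ _
      (hcar i)
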